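/- **Theorem 4.1.** For $g\in SL(2,\mathbb R)$ let $Q_g(v)=L_g^+(v)L_g^-(v)$, where $(L_g^-(v),L_g^+(v))=g^{-1}v$ for $v\in\mathbb R^2$; thus $Q_g(v)=Q_0(g^{-1}v)$ with $Q_0(x,y)=xy$. Let $SL(2,\mathbb R)$ act on $\mathbb R\cup\{\infty\}$ by Möbius transformations, and put $\lambda=\frac12(3-\sqrt5)$. The element $g$ is called $H$-reduced if the numbers $u=g(0)$ and $w=g(\infty)$ (the repelling and attracting endpoints of the geodesic $t\mapsto g\,\mathrm{diag}(e^{t/2},e^{-t/2})(i)$ of the upper half-plane) are real and satisfy $|w|>2$ and $\operatorname{sgn}(w)\,u\in[\lambda-1,\lambda]$. Let $g$ be $H$-reduced with $w=g(\infty)$ irrational, and let $w=[a_0,a_1,\dots]=a_0-\cfrac1{a_1-\cfrac1{a_2-\cdots}}$ be its minus continued fraction expansion with respect to the nearest integer (Hurwitz) algorithm: $w_0=w$, $a_j$ is the integer nearest to $w_j$, and $w_{j+1}=-1/(w_j-a_j)$. (Then $|a_j|\ge2$ for all $j$.) Let $0<\delta<\sqrt{2/\pi}$ and $\kappa>0$,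 and for $\rho>0$ let $$G(\rho)=\{p\in\mathbb Z^2 \text{ primitive}: 0<|Q_g(p)|<\tfrac12\delta^2,\ L_g^-(p)>\kappa,\ \|p\|\le\rho\},$$ where $\|\cdot\|$ is the Euclidean norm. For $n\in\mathbb N=\{0,1,2,\dots\}$ put $$\alpha_n=\sum_{j=0}^{n-1}\log|a_j|,\qquad \omega_n=\sum_{j=0}^{n-1}\chi_j,\qquad c_0=\tfrac12\log(3\sqrt5)+\tfrac12\log\Bigl(\tfrac34+\sqrt{\tfrac12}\Bigr),$$ $$e(\delta,n)=\#\{0\le j\le n-1: |a_j|>2\delta^{-2}+\tfrac12+\lambda\},\qquad f(\delta,n)=\#\{0\le j\le n-1: |a_j|>2\delta^{-2}-\tfrac32+\lambda\},$$ where $\chi_j=\frac12\log(3\sqrt5)$ if $|a_j|\ge3$, and $\chi_j=\log2-\frac12d\bigl(\mu+i\sqrt{1-\mu^2},\frac12(3+i\sqrt3)\bigr)$ if $|a_j|=2$, with $\mu=\frac1{22}(23-3\sqrt5)$ and $d$ the hyperbolic distance of the upper half-plane. Then there are constants $\theta\ge0$ and $\nu\in\mathbb N$ (depending only on $g$, $\delta$,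 $\kappa$) such that for all $n\in\mathbb N$ and all $\rho>0$: (i) if $\log\rho\ge\alpha_n+c_0n+\theta$, then $\#G(\rho)\ge e(\delta,n)-\nu$; (ii) if $\log\rho\le\alpha_n-\omega_n-\theta$, then $\#G(\rho)\le f(\delta,n)+\nu$. -/

import Mathlib

open scoped MatrixGroups

noncomputable section

namespace HReducedForms

/-! ### The quadratic form attached to `g ∈ SL(2, ℝ)` -/

/-- The real vector with integral coordinates `p = (x, y)`. -/
def realVec (p : ℤ × ℤ) : Fin 2 → ℝ := ![(p.1 : ℝ), (p.2 : ℝ)]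

/-- The set of primitive integral pairs. -/
def primitivePairs : Set (ℤ × ℤ) := {p | Int.gcd p.1 p.2 = 1}

/-- The Euclidean norm of an integral pair. -/
def euclNorm (p : ℤ × ℤ) : ℝ := ‖!₂[(p.1 : ℝ), (p.2 : ℝ)]‖

/-- The quadratic form `Q₀(x, y) = x y`. -/
def Q₀ (v : Fin 2 → ℝ) : ℝ := v 0 * v 1

/-- The quadratic form `Q_g(v) = Q₀(g⁻¹ v)`. -/
def Q (g : SL(2, ℝ)) (v : Fin 2 → ℝ) : ℝ :=
  Q₀ ((g⁻¹ : SL(2, ℝ)).val.mulVec v)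

/-- The linear form `L_g^-`: the first coordinate of `g⁻¹ v`. Under the flow
`g_t = g * diag (e ^ (t / 2), e ^ (-t / 2)) * g⁻¹`, which preserves `Q_g`, one has
`L_g^- (g_t v) = e ^ (t / 2) * L_g^- v`, so the orbits are asymptotic to `L_g^- = 0` as
`t → -∞`. -/
def Lminus (g : SL(2, ℝ)) (v : Fin 2 → ℝ) : ℝ := (g⁻¹ : SL(2, ℝ)).val.mulVec v 0

/-- The linear form `L_g^+`: the second coordinate of `g⁻¹ v`. -/
def Lplus (g : SL(2, ℝ)) (v : Fin 2 → ℝ) : ℝ := (g⁻¹ : SL(2, ℝ)).val.mulVec v 1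

theorem Q_eq_Lplus_mul_Lminus (g : SL(2, ℝ)) (v : Fin 2 → ℝ) :
    Q g v = Lplus g v * Lminus g v :=
  mul_comm _ _

/-- The set `G(ρ)` of primitive solutions `p` of `0 < |Q_g(p)| < δ² / 2`, `L_g^-(p) > κ`,
`‖p‖ ≤ ρ`. -/
def solutions (g : SL(2, ℝ)) (δ κ ρ : ℝ) : Set (ℤ × ℤ) :=
  {p | p ∈ primitivePairs ∧ 0 < |Q g (realVec p)| ∧ |Q g (realVec p)| < 1 / 2 * δ ^ 2 ∧
    κ < Lminus g (realVec p) ∧ euclNorm p ≤ ρ}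

/-- `G(ρ)` is finite, so that its `Set.ncard` is its cardinality. -/
theorem solutions_finite (g : SL(2, ℝ)) (δ κ ρ : ℝ) : (solutions g δ κ ρ).Finite := by
  refine ((Set.finite_Icc (-⌈ρ⌉) ⌈ρ⌉).prod (Set.finite_Icc (-⌈ρ⌉) ⌈ρ⌉)).subset ?_
  rintro ⟨x, y⟩ ⟨-, -, -, -, h⟩
  have h0 := PiLp.norm_apply_le (!₂[(x : ℝ), (y : ℝ)]) 0
  have h1 := PiLp.norm_apply_le (!₂[(x : ℝ), (y : ℝ)]) 1
  simp only [euclNorm] at h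
  have hx : |(x : ℝ)| ≤ ⌈ρ⌉ := by
    simpa using (h0.trans h).trans (Int.le_ceil ρ)
  have hy : |(y : ℝ)| ≤ ⌈ρ⌉ := by
    simpa using (h1.trans h).trans (Int.le_ceil ρ)
  rw [abs_le] at hx hy
  simp only [Set.mem_prod, Set.mem_Icc]
  exact ⟨⟨by exact_mod_cast hx.1, by exact_mod_cast hx.2⟩,
    ⟨by exact_mod_cast hy.1, by exact_mod_cast hy.2⟩⟩

/-! ### `H`-reduced elements -/

/-- `λ = (3 - √5) / 2`. -/
def lam : ℝ := (3 - √5) / 2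

/-- `g(ξ)` for `ξ` in the boundary `ℝ ∪ {∞}` of the upper half-plane (Möbius action). -/
def bdryAct (g : SL(2, ℝ)) (ξ : OnePoint ℝ) : OnePoint ℝ :=
  Matrix.SpecialLinearGroup.toGL g • ξ

theorem bdryAct_infty (g : SL(2, ℝ)) :
    bdryAct g OnePoint.infty =
      if g.val 1 0 = 0 then OnePoint.infty else ((g.val 0 0 / g.val 1 0 : ℝ) : OnePoint ℝ) :=
  OnePoint.smul_infty_eq_ite _

theorem bdryAct_coe (g : SL(2, ℝ)) (x : ℝ) :
    bdryAct g (x : OnePoint ℝ) =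
      if g.val 1 0 * x + g.val 1 1 = 0 then OnePoint.infty
      else (((g.val 0 0 * x + g.val 0 1) / (g.val 1 0 * x + g.val 1 1) : ℝ) : OnePoint ℝ) :=
  OnePoint.smul_some_eq_ite

/-- `g` is `H`-reduced: the geodesic `t ↦ g * diag (e ^ (t / 2), e ^ (-t / 2)) (i)`, which has
repelling endpoint `u = g(0)` and attracting endpoint `w = g(∞)`, satisfies `|w| > 2` and
`sgn(w) u ∈ [λ - 1, λ]`. Both endpoints are required to be real numbers. -/
def IsHReduced (g : SL(2, ℝ)) : Prop :=
  ∃ u w : ℝ, bdryAct g ((0 : ℝ) : OnePoint ℝ) = (u : OnePoint ℝ) ∧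
    bdryAct g OnePoint.infty = (w : OnePoint ℝ) ∧
    2 < |w| ∧ Real.sign w * u ∈ Set.Icc (lam - 1) lam

/-! ### The Hurwitz (nearest integer) algorithm for minus continued fractions -/

/-- The complete quotients: `w₀ = w`, `w_{j+1} = -1 / (w_j - a_j)`, with `a_j` the integer nearest
to `w_j`. For irrational `w` all the `w_j` are irrational: no division by zero, and the
nearest integer is unique. -/
def completeQuotient (w : ℝ) : ℕ → ℝ
  | 0 => w
  | j + 1 => -1 / (completeQuotient w j - (round (completeQuotient w j) : ℝ))

/-- The partial quotients `a_j` in `w = [a₀, a₁, …] = a₀ - 1 / (a₁ - 1 / (a₂ - ⋯))`. -/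
def digit (w : ℝ) (j : ℕ) : ℤ := round (completeQuotient w j)

/-- `|a_j|` as a real number. -/
def absDigit (w : ℝ) (j : ℕ) : ℝ := |(digit w j : ℝ)|

/-- `α_n = ∑_{j < n} log |a_j|`. -/
def alpha (w : ℝ) (n : ℕ) : ℝ := ∑ j ∈ Finset.range n, Real.log (absDigit w j)

/-- `e(δ, n)`, the number of `j < n` with `|a_j| > 2 δ⁻² + 1/2 + λ`. -/
def eCount (w δ : ℝ) (n : ℕ) : ℕ :=
  ((Finset.range n).filter fun j => 2 / δ ^ 2 + 1 / 2 + lam < absDigit w j).card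

/-- `f(δ, n)`, the number of `j < n` with `|a_j| > 2 δ⁻² - 3/2 + λ`. -/
def fCount (w δ : ℝ) (n : ℕ) : ℕ :=
  ((Finset.range n).filter fun j => 2 / δ ^ 2 - 3 / 2 + lam < absDigit w j).card

/-! ### The constants -/

/-- `c₀ = (1/2) log (3 √5) + (1/2) log (3/4 + √(1/2))`. -/
def c₀ : ℝ := 1 / 2 * Real.log (3 * √5) + 1 / 2 * Real.log (3 / 4 + √(1 / 2))

/-- `μ = (23 - 3 √5) / 22`. -/
def mu : ℝ := (23 - 3 * √5) / 22

theorem mu_sq_lt_one : mu ^ 2 < 1 := by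
  have h1 : (√5) ^ 2 = 5 := Real.sq_sqrt (by norm_num)
  have h2 : 0 ≤ √5 := Real.sqrt_nonneg 5
  have h3 : √5 < 3 := by nlinarith
  have h4 : 2 < √5 := by nlinarith
  unfold mu
  nlinarith

/-- The point `μ + i √(1 - μ²)` of the upper half-plane. -/
def cornerPoint : UpperHalfPlane :=
  ⟨⟨mu, √(1 - mu ^ 2)⟩, Real.sqrt_pos.mpr (sub_pos.mpr mu_sq_lt_one)⟩

/-- The point `(3 + i √3) / 2` of the upper half-plane. -/
def vertexPoint : UpperHalfPlane :=
  ⟨⟨3 / 2, √3 / 2⟩, half_pos (Real.sqrt_pos.mpr (by norm_num))⟩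

/-- `χ_j = log 2 - (1/2) d(μ + i √(1 - μ²), (3 + i √3) / 2)` if `|a_j| = 2`, where `d` is the
hyperbolic distance, and `χ_j = (1/2) log (3 √5)` otherwise, i.e. if `|a_j| ≥ 3`. -/
def chi (w : ℝ) (j : ℕ) : ℝ :=
  if |digit w j| = 2 then Real.log 2 - 1 / 2 * dist cornerPoint vertexPoint
  else 1 / 2 * Real.log (3 * √5)

/-- `ω_n = ∑_{j < n} χ_j`. -/
def omega (w : ℝ) (n : ℕ) : ℝ := ∑ j ∈ Finset.range n, chi w j

end HReducedForms

end

/-!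
Write `(u, w)` for the endpoints of `g` and `uₙ`, `wₙ` for their images under the successive maps
`ξ ↦ 1 / (aⱼ - ξ)`. The pairs `(uₙ, wₙ)` stay reduced, `|Q_g|` equals `1 / |wₙ - uₙ|` at the
`n`-th convergent, and `|wₙ - uₙ|` lies between `|aₙ| - (1 / 2 + λ)` and `|aₙ| + (3 / 2 - λ)`,
whence the thresholds in `e` and `f`. Conversely, by a Legendre-type criterion, every primitive
`(x, y)` with `|Q_g| < λ` and `|x - u y| ≥ 1` is a convergent up to sign, and the
number of points of `G(ρ)` with `|x - u y| < 1` is bounded uniformly in `ρ`. So counting solutions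
amounts to counting large digits, and the size of the `n`-th convergent is `∏ |aⱼ - uⱼ|`, which is
compared with `∏ |aⱼ|` factor by factor.
-/

noncomputable section

namespace HReducedForms

theorem lam_sq : lam ^ 2 = 3 * lam - 1 := by
  have h : √5 ^ 2 = 5 := Real.sq_sqrt (by norm_num)
  unfold lam
  linear_combination h / 4

theorem lam_mem_Ioo : lam ∈ Set.Ioo (0.38 : ℝ) 0.382 := by
  have hl : 2.236 < √5 := Real.lt_sqrt_of_sq_lt (by norm_num)
  have hu : √5 < 2.24 := (Real.sqrt_lt' (by norm_num)).mpr (by norm_num)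
  unfold lam
  constructor <;> linarith

/-! ### Reduced pairs -/

/-- The condition on the endpoints `(u, w)` of an `H`-reduced element. -/
def IsReduced (u w : ℝ) : Prop := 2 < |w| ∧ Real.sign w * u ∈ Set.Icc (lam - 1) lam

theorem isReduced_iff_of_pos {u w : ℝ} (hw : 0 < w) :
    IsReduced u w ↔ 2 < w ∧ lam - 1 ≤ u ∧ u ≤ lam := by
  rw [IsReduced, abs_of_pos hw, Real.sign_of_pos hw, one_mul, Set.mem_Icc]

theorem isReduced_neg_iff {u w : ℝ} : IsReduced (-u) (-w) ↔ IsReduced u w := by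
  rw [IsReduced, IsReduced, abs_neg, Real.sign_neg, neg_mul_neg]

theorem one_div_le_lam {t : ℝ} (ht : 3 - lam ≤ t) : 1 / t ≤ lam := by
  obtain ⟨hlam₀, hlam₁⟩ := lam_mem_Ioo
  rw [div_le_iff₀ (by linarith)]
  nlinarith [lam_sq]

theorem one_div_le_one_sub_lam {t : ℝ} (ht : 2 - lam ≤ t) : 1 / t ≤ 1 - lam := by
  obtain ⟨hlam₀, hlam₁⟩ := lam_mem_Ioo
  rw [div_le_iff₀ (by linarith)]
  nlinarith [lam_sq]

theorem mul_add_le_mul_of_le {c p₀ q₀ p q : ℝ} (hcp : c ≤ p₀) (hcq : c ≤ q₀)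
    (h₀ : c * (p₀ + q₀) ≤ p₀ * q₀) (hp : p₀ ≤ p) (hq : q₀ ≤ q) : c * (p + q) ≤ p * q := by
  have : (p₀ - c) * (q₀ - c) ≤ (p - c) * (q - c) := by
    apply mul_le_mul <;> linarith
  linarith

theorem lam_mul_sub_le_mul_of_lt {u w : ℝ} {a x : ℤ} (hw : 2 < w) (hu : u ≤ lam)
    (ha : |w - a| < 1 / 2) (hxa : x < a) (hx : 1 ≤ x - u) :
    lam * (w - u) ≤ (w - x) * (x - u) := by
  obtain ⟨hlam₀, hlam₁⟩ := lam_mem_Ioo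
  have hlam := lam_sq
  rw [show w - u = (w - x) + (x - u) by ring]
  by_cases hwx : 1 ≤ w - x
  · exact mul_add_le_mul_of_le (p₀ := 1) (q₀ := 1 - lam) (by linarith) (by linarith)
      (by linarith) hwx (by linarith)
  · have hx2 : (2 : ℝ) ≤ x := by
      have : (1 : ℝ) < x := by linarith
      exact_mod_cast this
    have hxa' : (x : ℝ) ≤ a - 1 := by exact_mod_cast Int.le_sub_one_of_lt hxa
    exact mul_add_le_mul_of_le (p₀ := 1 / 2) (q₀ := 2 - lam) (by linarith) (by linarith)
      (by linarith) (by linarith [(abs_lt.mp ha).1]) (by linarith)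

theorem lam_mul_sub_le_mul_of_pos {u w : ℝ} {a x y : ℤ} (hw : 2 < w) (hu : u ≤ lam)
    (ha : |w - a| < 1 / 2) (hy : 0 < y) (h₁ : 1 ≤ |x - u * y|) (h₂ : |x - u * y| < a - u) :
    lam * (w - u) ≤ |x - w * y| * |x - u * y| := by
  obtain ⟨hlam₀, hlam₁⟩ := lam_mem_Ioo
  have hlamD : lam * (w - u) ≤ w - u := mul_le_of_le_one_left (by linarith) (by linarith)
  rw [abs_sub_comm (x : ℝ) (w * y), show w * y - x = (w - u) * y - (x - u * y) by ring]
  rcases le_abs.mp h₁ with hs | hs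
  · rw [abs_of_pos (by linarith : 0 < x - u * y)] at h₂ ⊢
    refine le_trans ?_ (mul_le_mul_of_nonneg_right (le_abs_self _) (by linarith))
    rcases (by lia : y = 1 ∨ 2 ≤ y) with rfl | hy2
    · rw [Int.cast_one, mul_one] at hs h₂ ⊢
      rw [mul_one, sub_sub_sub_cancel_right]
      exact lam_mul_sub_le_mul_of_lt hw hu ha (by exact_mod_cast sub_lt_sub_iff_right u |>.mp h₂) hs
    · have hDy : (w - u) * 2 ≤ (w - u) * y :=
        mul_le_mul_of_nonneg_left (by exact_mod_cast hy2) (by linarith)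
      have hp : 1 ≤ (w - u) * y - (x - u * y) := by linarith [(abs_lt.mp ha).1]
      linarith [mul_nonneg (sub_nonneg.mpr hp) (sub_nonneg.mpr hs)]
  · have hDy : w - u ≤ (w - u) * y :=
      le_mul_of_one_le_right (by linarith) (by exact_mod_cast hy)
    calc lam * (w - u) ≤ (w - u) * 1 := by rwa [mul_one]
      _ ≤ |(w - u) * y - (x - u * y)| * |x - u * y| :=
        mul_le_mul ((by linarith : _ ≤ (w - u) * y - (x - u * y)).trans (le_abs_self _)) h₁
          zero_le_one (abs_nonneg _)

namespace IsReduced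

variable {u w : ℝ} {a : ℤ}

theorem ne_zero (h : IsReduced u w) : w ≠ 0 :=
  abs_pos.mp (two_pos.trans h.1)

theorem mul_digit_pos (h : IsReduced u w) (ha : |w - a| < 1 / 2) : 0 < w * a := by
  have := abs_lt.mp ha
  rcases lt_abs.mp h.1 with hw | hw
  · exact mul_pos (by linarith) (by linarith)
  · exact mul_pos_of_neg_of_neg (by linarith) (by linarith)

theorem two_le_abs_digit (h : IsReduced u w) (ha : |w - a| < 1 / 2) : 2 ≤ |(a : ℝ)| := by
  have : (1 : ℝ) < |(a : ℝ)| := by linarith [h.1, (abs_sub_abs_le_abs_sub w a)]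
  exact_mod_cast this

theorem abs_sub_mem_Icc (h : IsReduced u w) {t : ℝ} (ht : lam ≤ |t|) (hwt : 0 < w * t) :
    |t - u| ∈ Set.Icc (|t| - lam) (|t| + (1 - lam)) := by
  wlog hw : 0 < w generalizing u w t
  · have hw0 : w < 0 := (not_lt.mp hw).lt_of_ne h.ne_zero
    simpa only [abs_neg, neg_sub_neg, abs_sub_comm u t] using
      this (isReduced_neg_iff.mpr h) (t := -t) (by rwa [abs_neg]) (by rwa [neg_mul_neg])
        (neg_pos.mpr hw0)
  obtain ⟨-, hu₀, hu₁⟩ := (isReduced_iff_of_pos hw).mp h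
  rw [abs_of_pos (pos_of_mul_pos_right hwt hw.le)] at ht ⊢
  rw [abs_of_nonneg (by linarith)]
  constructor <;> linarith

theorem abs_digit_sub_mem_Icc (h : IsReduced u w) (ha : |w - a| < 1 / 2) :
    |a - u| ∈ Set.Icc (|(a : ℝ)| - lam) (|(a : ℝ)| + (1 - lam)) :=
  h.abs_sub_mem_Icc (by linarith [h.two_le_abs_digit ha, lam_mem_Ioo.2]) (h.mul_digit_pos ha)

theorem abs_sub_mem_Icc_abs (h : IsReduced u w) :
    |w - u| ∈ Set.Icc (|w| - lam) (|w| + (1 - lam)) :=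
  h.abs_sub_mem_Icc (by linarith [h.1, lam_mem_Ioo.2]) (mul_self_pos.mpr h.ne_zero)

theorem two_sub_lam_lt_abs_sub (h : IsReduced u w) : 2 - lam < |w - u| := by
  linarith [h.1, h.abs_sub_mem_Icc_abs.1]

theorem abs_sub_mem_Icc_digit (h : IsReduced u w) (ha : |w - a| < 1 / 2) :
    |w - u| ∈ Set.Icc (|(a : ℝ)| - (1 / 2 + lam)) (|(a : ℝ)| + (3 / 2 - lam)) := by
  obtain ⟨h₀, h₁⟩ := h.abs_sub_mem_Icc_abs
  have := abs_le.mp ((abs_abs_sub_abs_le w a).trans ha.le)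
  constructor <;> linarith

theorem step (h : IsReduced u w) (ha : |w - a| < 1 / 2) (hne : w ≠ a) :
    IsReduced (1 / (a - u)) (1 / (a - w)) := by
  wlog hw : 0 < w generalizing u w a
  · have hw0 : w < 0 := (not_lt.mp hw).lt_of_ne h.ne_zero
    have key := this (isReduced_neg_iff.mpr h) (a := -a)
      (by rwa [Int.cast_neg, neg_sub_neg, abs_sub_comm])
      (by rwa [Int.cast_neg, Ne, neg_inj]) (neg_pos.mpr hw0)
    rw [← isReduced_neg_iff]
    simpa only [Int.cast_neg, neg_sub_neg, ← div_neg, neg_sub] using key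
  obtain ⟨hw2, -, hu₁⟩ := (isReduced_iff_of_pos hw).mp h
  obtain ⟨hlam₀, hlam₁⟩ := lam_mem_Ioo
  obtain ⟨ha₀, ha₁⟩ := abs_lt.mp ha
  have ha2 : (2 : ℝ) ≤ a := by
    have : (1 : ℝ) < a := by linarith
    exact_mod_cast this
  have hpos : 0 < 1 / (a - u) := one_div_pos.mpr (by linarith)
  rcases lt_or_gt_of_ne hne with hlt | hgt
  · have ha3 : (3 : ℝ) ≤ a := by
      have : (2 : ℝ) < a := by linarith
      exact_mod_cast this
    refine (isReduced_iff_of_pos (one_div_pos.mpr (sub_pos.mpr hlt))).mpr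
      ⟨?_, by linarith, one_div_le_lam (by linarith)⟩
    rw [lt_div_iff₀ (sub_pos.mpr hlt)]
    linarith
  · have hwa : 0 < -(1 / (a - w)) := by
      rw [← div_neg, neg_sub]
      exact one_div_pos.mpr (sub_pos.mpr hgt)
    refine isReduced_neg_iff.mp ((isReduced_iff_of_pos hwa).mpr ⟨?_, ?_, by linarith⟩)
    · rw [← div_neg, neg_sub, lt_div_iff₀ (sub_pos.mpr hgt)]
      linarith
    · linarith [one_div_le_one_sub_lam (t := a - u) (by linarith)]

theorem abs_digit_le_abs_sub (h : IsReduced u w) (ha : |w - a| < 1 / 2) (hs : w * u ≤ 0) :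
    |(a : ℝ)| ≤ |a - u| := by
  have hau : a * u ≤ 0 := by
    have hwa := h.mul_digit_pos ha
    have : w ^ 2 * (a * u) ≤ 0 := by
      rw [show w ^ 2 * (a * u) = (w * a) * (w * u) by ring]
      exact mul_nonpos_of_nonneg_of_nonpos hwa.le hs
    exact nonpos_of_mul_nonpos_right this (by have := h.ne_zero; positivity)
  rw [← sq_le_sq]
  linarith [sub_sq (a : ℝ) u, sq_nonneg u]

theorem step_mul_nonpos_of_abs_digit_eq_two (h : IsReduced u w) (ha : |w - a| < 1 / 2)
    (ha2 : |(a : ℝ)| = 2) : 1 / (a - w) * (1 / (a - u)) ≤ 0 := by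
  have hwa := h.mul_digit_pos ha
  have hlam := lam_mem_Ioo.2
  rw [div_mul_div_comm, one_mul]
  refine div_nonpos_of_nonneg_of_nonpos zero_le_one ?_
  rcases abs_choice (a : ℝ) with he | he
  · have hw : 0 < w := pos_of_mul_pos_left hwa (by linarith [abs_nonneg (a : ℝ)])
    obtain ⟨hw2, -, hu⟩ := (isReduced_iff_of_pos hw).mp h
    exact mul_nonpos_of_nonpos_of_nonneg (by linarith) (by linarith)
  · have hw : 0 < -w := by nlinarith
    obtain ⟨hw2, -, hu⟩ := (isReduced_iff_of_pos hw).mp (isReduced_neg_iff.mpr h)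
    exact mul_nonpos_of_nonneg_of_nonpos (by linarith) (by linarith)

theorem lam_mul_abs_sub_le (h : IsReduced u w) (ha : |w - a| < 1 / 2) {x y : ℤ} (hy : y ≠ 0)
    (h₁ : 1 ≤ |x - u * y|) (h₂ : |x - u * y| < |a - u|) :
    lam * |w - u| ≤ |x - w * y| * |x - u * y| := by
  wlog hw : 0 < w generalizing u w a y
  · have hw0 : w < 0 := (not_lt.mp hw).lt_of_ne h.ne_zero
    simpa only [Int.cast_neg, neg_sub_neg, neg_mul_neg, abs_sub_comm u w] using
      this (isReduced_neg_iff.mpr h) (a := -a) (y := -y)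
        (by rwa [Int.cast_neg, neg_sub_neg, abs_sub_comm]) (neg_ne_zero.mpr hy)
        (by rwa [Int.cast_neg, neg_mul_neg])
        (by rwa [Int.cast_neg, Int.cast_neg, neg_mul_neg, neg_sub_neg, abs_sub_comm u])
        (neg_pos.mpr hw0)
  wlog hy0 : 0 < y generalizing x y
  · have abs_neg_lin (ξ : ℝ) : |((-x : ℤ) : ℝ) - ξ * ((-y : ℤ) : ℝ)| = |x - ξ * y| := by
      rw [Int.cast_neg, Int.cast_neg, mul_neg, neg_sub_neg, abs_sub_comm]
    simpa only [abs_neg_lin] using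
      this (x := -x) (y := -y) (by lia) (by rwa [abs_neg_lin]) (by rwa [abs_neg_lin]) (by lia)
  obtain ⟨hw2, -, hu⟩ := (isReduced_iff_of_pos hw).mp h
  have hlam := lam_mem_Ioo.2
  rw [abs_of_pos (by linarith [(abs_lt.mp ha).2] : 0 < a - u)] at h₂
  rw [abs_of_pos (by linarith : 0 < w - u)]
  exact lam_mul_sub_le_mul_of_pos hw2 hu ha hy0 h₁ h₂

end IsReduced

/-! ### Minus continued fractions -/

/-- The images of `ξ` under the successive maps `ξ ↦ 1 / (a_j - ξ)`; for `ξ = [a₀, a₁, …]` they are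
the complete quotients `[a_n, a_{n+1}, …]`. -/
def orbit (a : ℕ → ℤ) (ξ : ℝ) : ℕ → ℝ
  | 0 => ξ
  | n + 1 => 1 / (a n - orbit a ξ n)

/-- The linear form `x - ξ y`, proportional to `L_g^-` for `ξ = g(0)` and to `L_g^+` for
`ξ = g(∞)`. -/
def lin (ξ : ℝ) : ℤ × ℤ →+ ℝ :=
  AddMonoidHom.mk' (fun p => p.1 - ξ * p.2) fun p q => by
    simp only [Prod.fst_add, Prod.snd_add, Int.cast_add]
    ring

theorem lin_apply (ξ : ℝ) (p : ℤ × ℤ) : lin ξ p = p.1 - ξ * p.2 := rfl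

/-- The convergents of `[a₀, a₁, …]`, as pairs (numerator, denominator). The indexing is shifted so
that the recursion starts from `0 / (-1)` and `1 / 0`: the truncation `[a₀, …, a_n]` is
`convergent a (n + 2)`. -/
def convergent (a : ℕ → ℤ) : ℕ → ℤ × ℤ
  | 0 => (0, -1)
  | 1 => (1, 0)
  | n + 2 => a n • convergent a (n + 1) - convergent a n

theorem convergent_det (a : ℕ → ℤ) (n : ℕ) :
    (convergent a (n + 1)).2 * (convergent a n).1 -
      (convergent a (n + 1)).1 * (convergent a n).2 = 1 := by
  induction n with
  | zero => rfl
  | succ n ih =>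
    simp only [convergent, Prod.fst_sub, Prod.snd_sub, Prod.smul_fst, Prod.smul_snd, smul_eq_mul]
    linear_combination ih

theorem convergent_succ_mem_primitivePairs (a : ℕ → ℤ) (n : ℕ) :
    convergent a (n + 1) ∈ primitivePairs :=
  Int.isCoprime_iff_gcd_eq_one.mp
    ⟨-(convergent a n).2, (convergent a n).1, by linear_combination convergent_det a n⟩

theorem exists_eq_zsmul_convergent_sub (a : ℕ → ℤ) (n : ℕ) (p : ℤ × ℤ) :
    ∃ x y : ℤ, p = x • convergent a (n + 1) - y • convergent a n := by
  have h := convergent_det a n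
  refine ⟨p.2 * (convergent a n).1 - p.1 * (convergent a n).2,
    (convergent a (n + 1)).1 * p.2 - (convergent a (n + 1)).2 * p.1, Prod.ext ?_ ?_⟩
  · simp only [Prod.fst_sub, Prod.smul_fst, smul_eq_mul]
    linear_combination -p.1 * h
  · simp only [Prod.snd_sub, Prod.smul_snd, smul_eq_mul]
    linear_combination -p.2 * h

theorem neg_mem_primitivePairs_iff {p : ℤ × ℤ} : -p ∈ primitivePairs ↔ p ∈ primitivePairs := by
  simp only [primitivePairs, Set.mem_ofPred_eq, Prod.fst_neg, Prod.snd_neg, Int.gcd_neg,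
    Int.neg_gcd]

theorem eq_or_eq_neg_of_zsmul_mem_primitivePairs {x : ℤ} {p : ℤ × ℤ}
    (h : x • p ∈ primitivePairs) : x • p = p ∨ x • p = -p := by
  simp only [primitivePairs, Set.mem_ofPred_eq, Prod.smul_fst, Prod.smul_snd, smul_eq_mul,
    Int.gcd_mul_left] at h
  refine (Int.natAbs_eq_iff.mp (Nat.eq_one_of_mul_eq_one_right h)).imp ?_ ?_ <;> rintro rfl
  · exact one_smul ℤ p
  · exact neg_one_smul ℤ p

theorem lin_convergent_add_two (a : ℕ → ℤ) (ξ : ℝ) (n : ℕ) :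
    lin ξ (convergent a (n + 2)) = a n * lin ξ (convergent a (n + 1)) - lin ξ (convergent a n) := by
  rw [convergent, map_sub, map_zsmul, zsmul_eq_mul]

theorem lin_convergent_eq_orbit_mul {a : ℕ → ℤ} {ξ : ℝ} (hne : ∀ n, orbit a ξ n ≠ a n) (n : ℕ) :
    lin ξ (convergent a n) = orbit a ξ n * lin ξ (convergent a (n + 1)) := by
  induction n with
  | zero => simp [lin_apply, convergent, orbit]
  | succ n ih =>
    rw [lin_convergent_add_two, ih, orbit, ← sub_mul, ← mul_assoc,
      one_div_mul_cancel (sub_ne_zero.mpr (hne n).symm), one_mul]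

theorem lin_convergent_add_two_eq_sub_orbit_mul {a : ℕ → ℤ} {ξ : ℝ}
    (hne : ∀ n, orbit a ξ n ≠ a n) (n : ℕ) :
    lin ξ (convergent a (n + 2)) = (a n - orbit a ξ n) * lin ξ (convergent a (n + 1)) := by
  rw [lin_convergent_add_two, lin_convergent_eq_orbit_mul hne n, sub_mul]

theorem lin_zsmul_convergent_sub {a : ℕ → ℤ} {ξ : ℝ} (hne : ∀ n, orbit a ξ n ≠ a n) (n : ℕ)
    (x y : ℤ) : lin ξ (x • convergent a (n + 1) - y • convergent a n) =
      (x - orbit a ξ n * y) * lin ξ (convergent a (n + 1)) := by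
  rw [map_sub, map_zsmul, map_zsmul, zsmul_eq_mul, zsmul_eq_mul, lin_convergent_eq_orbit_mul hne n]
  ring

theorem lin_convergent_mul_lin_convergent {a : ℕ → ℤ} {u w : ℝ} (hu : ∀ n, orbit a u n ≠ a n)
    (hw : ∀ n, orbit a w n ≠ a n) (n : ℕ) :
    lin w (convergent a (n + 1)) * lin u (convergent a (n + 1)) *
      (orbit a w n - orbit a u n) = w - u := by
  have hdet : ((convergent a (n + 1)).2 : ℝ) * (convergent a n).1 -
      (convergent a (n + 1)).1 * (convergent a n).2 = 1 := by
    exact_mod_cast convergent_det a n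
  have hu := lin_convergent_eq_orbit_mul hu n
  have hw := lin_convergent_eq_orbit_mul hw n
  simp only [lin_apply] at hu hw ⊢
  linear_combination (w - u) * hdet -
    ((convergent a (n + 1)).1 - u * (convergent a (n + 1)).2) * hw +
    ((convergent a (n + 1)).1 - w * (convergent a (n + 1)).2) * hu

/-! ### Reduced expansions -/

/-- The digits `a` drive the reduced pair `(u, w)` through reduced pairs. Since each complete
quotient of `w` exceeds `2` in absolute value, every `a_n` is the nearest integer to its complete
quotient. -/
def IsReducedExpansion (a : ℕ → ℤ) (u w : ℝ) : Prop :=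
  ∀ n, IsReduced (orbit a u n) (orbit a w n)

theorem orbit_digit (w : ℝ) (n : ℕ) : orbit (digit w) w n = completeQuotient w n := by
  induction n with
  | zero => rfl
  | succ n ih => rw [orbit, ih, completeQuotient, digit, ← neg_sub, one_div_neg_eq_neg_one_div,
      neg_div]

theorem irrational_completeQuotient {w : ℝ} (hw : Irrational w) (n : ℕ) :
    Irrational (completeQuotient w n) := by
  induction n with
  | zero => exact hw
  | succ n ih =>
    rw [completeQuotient, neg_div, one_div]
    exact (ih.sub_intCast _).inv.neg

theorem abs_sub_round_lt_of_irrational {x : ℝ} (hx : Irrational x) : |x - round x| < 1 / 2 := by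
  refine (abs_sub_round x).lt_of_ne fun h => ?_
  rcases (abs_eq one_half_pos.le).mp h with h | h
  · exact (hx.sub_intCast (round x)).ne_rational 1 2 (by rw [h]; norm_num)
  · exact (hx.sub_intCast (round x)).ne_rational (-1) 2 (by rw [h]; norm_num)

theorem IsReduced.isReducedExpansion_digit {u w : ℝ} (h : IsReduced u w) (hw : Irrational w) :
    IsReducedExpansion (digit w) u w := by
  intro n
  induction n with
  | zero => exact h
  | succ n ih =>
    have hirr := irrational_completeQuotient hw n
    refine ih.step ?_ ?_ <;> rw [orbit_digit]
    · exact abs_sub_round_lt_of_irrational hirr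
    · exact hirr.ne_int _

namespace IsReducedExpansion

variable {a : ℕ → ℤ} {u w : ℝ}

theorem orbit_right_ne_digit (h : IsReducedExpansion a u w) (n : ℕ) : orbit a w n ≠ a n := by
  have : 1 / (a n - orbit a w n) ≠ 0 := (h (n + 1)).ne_zero
  exact fun heq => this (by rw [heq, sub_self, div_zero])

theorem abs_orbit_right_sub_digit_lt (h : IsReducedExpansion a u w) (n : ℕ) :
    |orbit a w n - a n| < 1 / 2 := by
  have hpos : 0 < |orbit a w n - a n| := abs_pos.mpr (sub_ne_zero.mpr (h.orbit_right_ne_digit n))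
  have : 2 < |1 / (a n - orbit a w n)| := (h (n + 1)).1
  rw [abs_div, abs_one, abs_sub_comm] at this
  exact (lt_one_div two_pos hpos).mp this

theorem two_le_abs_digit (h : IsReducedExpansion a u w) (n : ℕ) : 2 ≤ |(a n : ℝ)| :=
  (h n).two_le_abs_digit (h.abs_orbit_right_sub_digit_lt n)

theorem three_halves_le_abs_digit_sub (h : IsReducedExpansion a u w) (n : ℕ) :
    3 / 2 ≤ |a n - orbit a u n| := by
  linarith [((h n).abs_digit_sub_mem_Icc (h.abs_orbit_right_sub_digit_lt n)).1,
    h.two_le_abs_digit n, lam_mem_Ioo.2]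

theorem orbit_left_ne_digit (h : IsReducedExpansion a u w) (n : ℕ) : orbit a u n ≠ a n := by
  refine (sub_ne_zero.mp (abs_pos.mp ?_)).symm
  linarith [h.three_halves_le_abs_digit_sub n]

theorem abs_orbit_sub_mem_Icc (h : IsReducedExpansion a u w) (n : ℕ) :
    |orbit a w n - orbit a u n| ∈
      Set.Icc (|(a n : ℝ)| - (1 / 2 + lam)) (|(a n : ℝ)| + (3 / 2 - lam)) :=
  (h n).abs_sub_mem_Icc_digit (h.abs_orbit_right_sub_digit_lt n)

theorem abs_lin_left_convergent_one : |lin u (convergent a 1)| = 1 := by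
  simp [lin_apply, convergent]

theorem abs_lin_left_convergent_add_two (h : IsReducedExpansion a u w) (n : ℕ) :
    |lin u (convergent a (n + 2))| = |a n - orbit a u n| * |lin u (convergent a (n + 1))| := by
  rw [lin_convergent_add_two_eq_sub_orbit_mul h.orbit_left_ne_digit, abs_mul]

theorem pow_le_abs_lin_left_convergent (h : IsReducedExpansion a u w) (n : ℕ) :
    (3 / 2 : ℝ) ^ n ≤ |lin u (convergent a (n + 1))| := by
  induction n with
  | zero => rw [pow_zero, abs_lin_left_convergent_one]
  | succ n ih =>
    rw [h.abs_lin_left_convergent_add_two, pow_succ']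
    exact mul_le_mul (h.three_halves_le_abs_digit_sub n) ih (by positivity) (abs_nonneg _)

theorem one_le_abs_lin_left_convergent (h : IsReducedExpansion a u w) (n : ℕ) :
    1 ≤ |lin u (convergent a (n + 1))| :=
  (one_le_pow₀ (by norm_num)).trans (h.pow_le_abs_lin_left_convergent n)

theorem strictMono_abs_lin_left_convergent (h : IsReducedExpansion a u w) :
    StrictMono fun n => |lin u (convergent a (n + 1))| :=
  strictMono_nat_of_lt_succ fun n => by
    rw [h.abs_lin_left_convergent_add_two]
    exact lt_mul_of_one_lt_left (one_pos.trans_le (h.one_le_abs_lin_left_convergent n))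
      (by linarith [h.three_halves_le_abs_digit_sub n])

theorem abs_lin_right_convergent_le_one (h : IsReducedExpansion a u w) (n : ℕ) :
    |lin w (convergent a (n + 1))| ≤ 1 := by
  induction n with
  | zero => simp [lin_apply, convergent]
  | succ n ih =>
    rw [lin_convergent_add_two_eq_sub_orbit_mul h.orbit_right_ne_digit, abs_mul, abs_sub_comm]
    exact mul_le_one₀ (by linarith [h.abs_orbit_right_sub_digit_lt n]) (abs_nonneg _) ih

theorem abs_lin_mul_abs_lin_convergent_mul (h : IsReducedExpansion a u w) (n : ℕ) :
    |lin w (convergent a (n + 1))| * |lin u (convergent a (n + 1))| *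
      |orbit a w n - orbit a u n| = |w - u| := by
  rw [← abs_mul, ← abs_mul,
    lin_convergent_mul_lin_convergent h.orbit_left_ne_digit h.orbit_right_ne_digit]

theorem exists_abs_lin_left_convergent_le_and_lt (h : IsReducedExpansion a u w) {x : ℝ}
    (hx : 1 ≤ x) :
    ∃ n, |lin u (convergent a (n + 1))| ≤ x ∧ x < |lin u (convergent a (n + 2))| := by
  by_contra! hstep
  have hbdd (n : ℕ) : |lin u (convergent a (n + 1))| ≤ x := by
    induction n with
    | zero => rwa [abs_lin_left_convergent_one]
    | succ n ih => exact hstep n ih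
  obtain ⟨n, hn⟩ := pow_unbounded_of_one_lt x (by norm_num : (1 : ℝ) < 3 / 2)
  exact (hn.trans_le (h.pow_le_abs_lin_left_convergent n)).not_ge (hbdd n)

theorem exists_eq_convergent_or_eq_neg (h : IsReducedExpansion a u w) {p : ℤ × ℤ}
    (hp : p ∈ primitivePairs) (h₁ : 1 ≤ |lin u p|)
    (h₂ : |lin w p| * |lin u p| < lam * |w - u|) :
    ∃ n, p = convergent a (n + 1) ∨ p = -convergent a (n + 1) := by
  obtain ⟨n, hle, hlt⟩ := h.exists_abs_lin_left_convergent_le_and_lt h₁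
  refine ⟨n, ?_⟩
  obtain ⟨x, y, rfl⟩ := exists_eq_zsmul_convergent_sub a n p
  rw [lin_zsmul_convergent_sub h.orbit_left_ne_digit, abs_mul] at hle hlt h₂
  rw [lin_zsmul_convergent_sub h.orbit_right_ne_digit, abs_mul,
    ← h.abs_lin_mul_abs_lin_convergent_mul n] at h₂
  have hpos : 0 < |lin u (convergent a (n + 1))| :=
    one_pos.trans_le (h.one_le_abs_lin_left_convergent n)
  have hy : y = 0 := by
    by_contra hy
    have key := (h n).lam_mul_abs_sub_le (h.abs_orbit_right_sub_digit_lt n) (x := x) hy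
      (le_of_mul_le_mul_right (by rwa [one_mul]) hpos)
      (lt_of_mul_lt_mul_right (by rwa [← h.abs_lin_left_convergent_add_two]) hpos.le)
    refine h₂.not_ge ?_
    linarith [mul_le_mul_of_nonneg_left key
      (mul_nonneg (abs_nonneg (lin w (convergent a (n + 1)))) hpos.le)]
  subst hy
  rw [zero_smul, sub_zero] at hp ⊢
  exact eq_or_eq_neg_of_zsmul_mem_primitivePairs hp

end IsReducedExpansion

/-! ### Growth of the convergents -/

/-- The factor by which `|x - u y|` may lag behind in the comparison with a product of weights. A
digit `±2` may gain less than a factor `2` only when `u` and `w` have the same sign, that is only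
after a digit of absolute value at least `3`, and that digit has gained a spare factor `2`. -/
def growthSlack (u w : ℝ) : ℝ := if w * u ≤ 0 then 2 else 1

theorem growthSlack_mem_Icc (u w : ℝ) : growthSlack u w ∈ Set.Icc 1 2 := by
  unfold growthSlack
  split_ifs <;> norm_num

theorem IsReduced.mul_growthSlack_le {u w b : ℝ} {a : ℤ} (h : IsReduced u w)
    (ha : |w - a| < 1 / 2) (hb₂ : |(a : ℝ)| = 2 → b ≤ 2)
    (hb₃ : 3 ≤ |(a : ℝ)| → b ≤ |(a : ℝ)| * (2 / 5)) :
    b * growthSlack u w ≤ growthSlack (1 / (a - u)) (1 / (a - w)) * |a - u| := by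
  have hau := (h.abs_digit_sub_mem_Icc ha).1
  have hlam := lam_mem_Ioo.2
  obtain ha₂ | ha₃ : |(a : ℝ)| = 2 ∨ 3 ≤ |(a : ℝ)| := by
    have := h.two_le_abs_digit ha
    norm_cast at this ⊢
    lia
  · rw [growthSlack, growthSlack, if_pos (h.step_mul_nonpos_of_abs_digit_eq_two ha ha₂)]
    split_ifs with hs
    · linarith [hb₂ ha₂, h.abs_digit_le_abs_sub ha hs]
    · linarith [hb₂ ha₂]
  · calc b * growthSlack u w ≤ (|(a : ℝ)| * (2 / 5)) * 2 :=
          mul_le_mul (hb₃ ha₃) (growthSlack_mem_Icc u w).2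
            (one_pos.le.trans (growthSlack_mem_Icc u w).1) (by positivity)
      _ ≤ 1 * |a - u| := by linarith
      _ ≤ _ := mul_le_mul_of_nonneg_right (growthSlack_mem_Icc _ _).1 (abs_nonneg _)

namespace IsReducedExpansion

variable {a : ℕ → ℤ} {u w : ℝ}

theorem abs_lin_left_convergent_le_prod (h : IsReducedExpansion a u w) {B : ℝ} (hB : 3 / 2 ≤ B)
    (n : ℕ) : |lin u (convergent a (n + 1))| ≤ ∏ j ∈ Finset.range n, (|(a j : ℝ)| * B) := by
  induction n with
  | zero => rw [Finset.prod_range_zero, abs_lin_left_convergent_one]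
  | succ n ih =>
    rw [h.abs_lin_left_convergent_add_two, Finset.prod_range_succ, mul_comm]
    refine mul_le_mul ih ?_ (abs_nonneg _) ((abs_nonneg _).trans ih)
    have hau := ((h n).abs_digit_sub_mem_Icc (h.abs_orbit_right_sub_digit_lt n)).2
    calc |a n - orbit a u n| ≤ |(a n : ℝ)| * (3 / 2) := by
          linarith [h.two_le_abs_digit n, lam_mem_Ioo.1]
      _ ≤ |(a n : ℝ)| * B := mul_le_mul_of_nonneg_left hB (abs_nonneg _)

theorem prod_le_two_mul_abs_lin_left_convergent (h : IsReducedExpansion a u w) {b : ℕ → ℝ}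
    (hb : ∀ j, 0 ≤ b j) (hb₂ : ∀ j, |(a j : ℝ)| = 2 → b j ≤ 2)
    (hb₃ : ∀ j, 3 ≤ |(a j : ℝ)| → b j ≤ |(a j : ℝ)| * (2 / 5)) (n : ℕ) :
    ∏ j ∈ Finset.range n, b j ≤ 2 * |lin u (convergent a (n + 1))| := by
  have key : ∏ j ∈ Finset.range n, b j ≤
      growthSlack (orbit a u n) (orbit a w n) * |lin u (convergent a (n + 1))| := by
    induction n with
    | zero =>
      rw [Finset.prod_range_zero, abs_lin_left_convergent_one, mul_one]
      exact (growthSlack_mem_Icc _ _).1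
    | succ n ih =>
      rw [Finset.prod_range_succ, h.abs_lin_left_convergent_add_two, ← mul_assoc]
      calc (∏ j ∈ Finset.range n, b j) * b n
          ≤ growthSlack (orbit a u n) (orbit a w n) * |lin u (convergent a (n + 1))| * b n :=
            mul_le_mul_of_nonneg_right ih (hb n)
        _ = b n * growthSlack (orbit a u n) (orbit a w n) * |lin u (convergent a (n + 1))| := by
            ring
        _ ≤ _ := mul_le_mul_of_nonneg_right ((h n).mul_growthSlack_le
            (h.abs_orbit_right_sub_digit_lt n) (hb₂ n) (hb₃ n)) (abs_nonneg _)
  exact key.trans (mul_le_mul_of_nonneg_right (growthSlack_mem_Icc _ _).2 (abs_nonneg _))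

end IsReducedExpansion

theorem three_halves_le_exp_c₀ : 3 / 2 ≤ Real.exp c₀ := by
  have h5 : 9 / 4 ≤ 3 * √5 := by
    linarith [(Real.le_sqrt_of_sq_le (by norm_num) : (2 : ℝ) ≤ √5)]
  have h2 : 1 ≤ 3 / 4 + √(1 / 2 : ℝ) := by
    linarith [(Real.le_sqrt_of_sq_le (by norm_num) : (1 / 2 : ℝ) ≤ √(1 / 2))]
  have hlog : Real.log (9 / 4) = 2 * Real.log (3 / 2) := by
    rw [show (9 / 4 : ℝ) = (3 / 2) ^ 2 by norm_num, Real.log_pow, Nat.cast_ofNat]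
  rw [← Real.log_le_iff_le_exp (by norm_num), c₀]
  linarith [Real.log_le_log (by norm_num) h5, Real.log_nonneg h2]

theorem cosh_dist_cornerPoint_vertexPoint :
    Real.cosh (dist cornerPoint vertexPoint) = (4 - 3 * mu) / (√(1 - mu ^ 2) * √3) := by
  have hy : √(1 - mu ^ 2) ^ 2 = 1 - mu ^ 2 := Real.sq_sqrt (sub_pos.mpr mu_sq_lt_one).le
  have h3 : √3 ^ 2 = 3 := Real.sq_sqrt (by norm_num)
  rw [UpperHalfPlane.cosh_dist']
  change ((mu - 3 / 2) ^ 2 + √(1 - mu ^ 2) ^ 2 + (√3 / 2) ^ 2) / (2 * √(1 - mu ^ 2) * (√3 / 2)) = _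
  rw [hy, div_pow, h3]
  congr 1 <;> ring

theorem dist_cornerPoint_vertexPoint_le : dist cornerPoint vertexPoint ≤ 2 * Real.log 2 := by
  have hcosh : Real.cosh (2 * Real.log 2) = 17 / 8 := by
    rw [show 2 * Real.log 2 = Real.log (2 ^ 2) by rw [Real.log_pow, Nat.cast_ofNat],
      Real.cosh_log (by norm_num)]
    norm_num
  have h5l : 2.2 < √5 := Real.lt_sqrt_of_sq_lt (by norm_num)
  have h5u : √5 < 2.3 := (Real.sqrt_lt' (by norm_num)).mpr (by norm_num)
  have hmul : 0.73 ≤ mu := by unfold mu; linarith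
  have hmuu : mu ≤ 0.75 := by unfold mu; linarith
  have hy : 0.66 ≤ √(1 - mu ^ 2) := Real.le_sqrt_of_sq_le (by nlinarith)
  have h3 : 1.73 ≤ √3 := Real.le_sqrt_of_sq_le (by norm_num)
  have hpos : 0 < √(1 - mu ^ 2) * √3 := by positivity
  rw [← abs_of_nonneg (by positivity : 0 ≤ 2 * Real.log 2), ← abs_dist, ← Real.cosh_le_cosh, hcosh,
    cosh_dist_cornerPoint_vertexPoint, div_le_iff₀ hpos]
  linarith [mul_le_mul hy h3 (by norm_num) (Real.sqrt_nonneg _)]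

theorem exp_neg_chi_le_one {w : ℝ} {j : ℕ} (h : |digit w j| = 2) : Real.exp (-chi w j) ≤ 1 := by
  rw [Real.exp_le_one_iff, chi, if_pos h]
  linarith [dist_cornerPoint_vertexPoint_le]

theorem exp_neg_chi_le_two_fifths {w : ℝ} {j : ℕ} (h : |digit w j| ≠ 2) :
    Real.exp (-chi w j) ≤ 2 / 5 := by
  have h5 : 25 / 4 ≤ 3 * √5 := by
    linarith [(Real.le_sqrt_of_sq_le (by norm_num) : (2.2 : ℝ) ≤ √5)]
  have hlog : Real.log (25 / 4) = -(2 * Real.log (2 / 5)) := by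
    rw [show (25 / 4 : ℝ) = ((2 / 5) ^ 2)⁻¹ by norm_num, Real.log_inv, Real.log_pow,
      Nat.cast_ofNat]
  rw [← Real.le_log_iff_exp_le (by norm_num), chi, if_neg h]
  linarith [Real.log_le_log (by norm_num) h5]

theorem prod_absDigit_mul_exp {w : ℝ} (hw : ∀ j, 0 < absDigit w j) (f : ℕ → ℝ) (n : ℕ) :
    ∏ j ∈ Finset.range n, absDigit w j * Real.exp (f j) =
      Real.exp (alpha w n + ∑ j ∈ Finset.range n, f j) := by
  simp only [alpha, ← Finset.sum_add_distrib, Real.exp_sum, Real.exp_add, Real.exp_log (hw _)]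

namespace IsReducedExpansion

variable {u w : ℝ}

theorem absDigit_pos (h : IsReducedExpansion (digit w) u w) (j : ℕ) : 0 < absDigit w j :=
  two_pos.trans_le (h.two_le_abs_digit j)

theorem abs_lin_left_convergent_le_exp (h : IsReducedExpansion (digit w) u w) {m n : ℕ}
    (hmn : m ≤ n) :
    |lin u (convergent (digit w) (m + 1))| ≤ Real.exp (alpha w n + c₀ * n) := by
  have hprod := prod_absDigit_mul_exp h.absDigit_pos (fun _ => c₀) n
  rw [Finset.sum_const, Finset.card_range, nsmul_eq_mul, mul_comm (n : ℝ)] at hprod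
  rw [← hprod]
  exact (h.strictMono_abs_lin_left_convergent.monotone hmn).trans
    (h.abs_lin_left_convergent_le_prod three_halves_le_exp_c₀ n)

theorem exp_le_two_mul_abs_lin_left_convergent (h : IsReducedExpansion (digit w) u w) (n : ℕ) :
    Real.exp (alpha w n - omega w n) ≤ 2 * |lin u (convergent (digit w) (n + 1))| := by
  have hprod := prod_absDigit_mul_exp h.absDigit_pos (fun j => -chi w j) n
  rw [Finset.sum_neg_distrib, ← sub_eq_add_neg] at hprod
  rw [omega, ← hprod]
  refine h.prod_le_two_mul_abs_lin_left_convergent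
    (fun j => mul_nonneg (abs_nonneg _) (Real.exp_pos _).le) (fun j hj => ?_) (fun j hj => ?_) n
  · rw [hj]
    linarith [exp_neg_chi_le_one (w := w) (j := j) (by exact_mod_cast hj)]
  · refine mul_le_mul_of_nonneg_left (exp_neg_chi_le_two_fifths fun h₂ => ?_) (abs_nonneg _)
    have : |(digit w j : ℝ)| = 2 := by exact_mod_cast h₂
    linarith

end IsReducedExpansion

/-! ### The form `Q_g` in terms of the endpoints -/

theorem abs_lin_le_mul_euclNorm (ξ : ℝ) (p : ℤ × ℤ) : |lin ξ p| ≤ (1 + |ξ|) * euclNorm p := by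
  have h₁ : |(p.1 : ℝ)| ≤ euclNorm p := PiLp.norm_apply_le (!₂[(p.1 : ℝ), (p.2 : ℝ)]) 0
  have h₂ : |(p.2 : ℝ)| ≤ euclNorm p := PiLp.norm_apply_le (!₂[(p.1 : ℝ), (p.2 : ℝ)]) 1
  calc |lin ξ p| ≤ |(p.1 : ℝ)| + |ξ * p.2| := abs_sub _ _
    _ = |(p.1 : ℝ)| + |ξ| * |(p.2 : ℝ)| := by rw [abs_mul]
    _ ≤ euclNorm p + |ξ| * euclNorm p :=
      add_le_add h₁ (mul_le_mul_of_nonneg_left h₂ (abs_nonneg _))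
    _ = (1 + |ξ|) * euclNorm p := by ring

theorem euclNorm_le_abs_add_abs (p : ℤ × ℤ) : euclNorm p ≤ |(p.1 : ℝ)| + |(p.2 : ℝ)| := by
  rw [euclNorm, EuclideanSpace.norm_eq, Real.sqrt_le_left (by positivity)]
  simp only [Fin.sum_univ_two, Matrix.cons_val_zero, Matrix.cons_val_one, Real.norm_eq_abs]
  nlinarith [abs_nonneg (p.1 : ℝ), abs_nonneg (p.2 : ℝ)]

theorem euclNorm_neg (p : ℤ × ℤ) : euclNorm (-p) = euclNorm p := by
  simp [euclNorm, EuclideanSpace.norm_eq]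

theorem exists_euclNorm_le_mul_abs_lin {u w : ℝ} (h : u ≠ w) :
    ∃ C > 0, ∀ p : ℤ × ℤ, euclNorm p ≤ C * (|lin u p| + |lin w p|) := by
  have hpos : 0 < |w - u| := abs_pos.mpr (sub_ne_zero.mpr h.symm)
  refine ⟨1 + (1 + |u|) / |w - u|, by positivity, fun p => ?_⟩
  have h₂ : |(p.2 : ℝ)| ≤ (|lin u p| + |lin w p|) / |w - u| := by
    rw [le_div_iff₀ hpos, ← abs_mul,
      show (p.2 : ℝ) * (w - u) = lin u p - lin w p by simp only [lin_apply]; ring]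
    exact abs_sub _ _
  have h₁ : |(p.1 : ℝ)| ≤ |lin u p| + |u| * |(p.2 : ℝ)| := by
    rw [← abs_mul, show (p.1 : ℝ) = lin u p + u * p.2 by rw [lin_apply]; ring]
    exact abs_add_le _ _
  calc euclNorm p ≤ |(p.1 : ℝ)| + |(p.2 : ℝ)| := euclNorm_le_abs_add_abs p
    _ ≤ |lin u p| + (1 + |u|) * |(p.2 : ℝ)| := by linarith
    _ ≤ (|lin u p| + |lin w p|) + (1 + |u|) * ((|lin u p| + |lin w p|) / |w - u|) := by
      gcongr
      linarith [abs_nonneg (lin w p)]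
    _ = (1 + (1 + |u|) / |w - u|) * (|lin u p| + |lin w p|) := by ring

/-- The repelling and attracting endpoints of the geodesic attached to `g` are the real numbers `u`
and `w`. -/
structure HasEndpoints (g : SL(2, ℝ)) (u w : ℝ) : Prop where
  apply_zero : bdryAct g ((0 : ℝ) : OnePoint ℝ) = (u : OnePoint ℝ)
  apply_infty : bdryAct g OnePoint.infty = (w : OnePoint ℝ)

namespace HasEndpoints

variable {g : SL(2, ℝ)} {u w : ℝ}

theorem bottom_right_ne_zero (hg : HasEndpoints g u w) : g.val 1 1 ≠ 0 := fun h => by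
  have := hg.apply_zero
  rw [bdryAct_coe, mul_zero, zero_add, if_pos h] at this
  exact OnePoint.infty_ne_coe _ this

theorem bottom_left_ne_zero (hg : HasEndpoints g u w) : g.val 1 0 ≠ 0 := fun h => by
  have := hg.apply_infty
  rw [bdryAct_infty, if_pos h] at this
  exact OnePoint.infty_ne_coe _ this

theorem top_right_eq (hg : HasEndpoints g u w) : g.val 0 1 = u * g.val 1 1 := by
  have := hg.apply_zero
  rw [bdryAct_coe, mul_zero, mul_zero, zero_add, zero_add, if_neg hg.bottom_right_ne_zero] at this
  exact (div_eq_iff hg.bottom_right_ne_zero).mp (OnePoint.coe_injective this)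

theorem top_left_eq (hg : HasEndpoints g u w) : g.val 0 0 = w * g.val 1 0 := by
  have := hg.apply_infty
  rw [bdryAct_infty, if_neg hg.bottom_left_ne_zero] at this
  exact (div_eq_iff hg.bottom_left_ne_zero).mp (OnePoint.coe_injective this)

theorem bottom_mul_sub_eq_one (hg : HasEndpoints g u w) :
    g.val 1 0 * g.val 1 1 * (w - u) = 1 := by
  have hdet : g.val 0 0 * g.val 1 1 - g.val 0 1 * g.val 1 0 = 1 := by
    rw [← Matrix.det_fin_two]
    exact g.2
  linear_combination hdet - g.val 1 1 * hg.top_left_eq + g.val 1 0 * hg.top_right_eq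

theorem ne (hg : HasEndpoints g u w) : u ≠ w :=
  (sub_ne_zero.mp (right_ne_zero_of_mul_eq_one hg.bottom_mul_sub_eq_one)).symm

theorem Lminus_realVec (hg : HasEndpoints g u w) (p : ℤ × ℤ) :
    Lminus g (realVec p) = g.val 1 1 * lin u p := by
  have : Lminus g (realVec p) = p.1 * g.val 1 1 - p.2 * g.val 0 1 := by
    simp [Lminus, Matrix.adjugate_fin_two, Matrix.vecHead, Matrix.vecTail, realVec,
      ← sub_eq_add_neg]
  rw [this, lin_apply]
  linear_combination -(p.2 : ℝ) * hg.top_right_eq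

theorem Lplus_realVec (hg : HasEndpoints g u w) (p : ℤ × ℤ) :
    Lplus g (realVec p) = -g.val 1 0 * lin w p := by
  have : Lplus g (realVec p) = p.2 * g.val 0 0 - p.1 * g.val 1 0 := by
    simp [Lplus, Matrix.adjugate_fin_two, Matrix.vecHead, Matrix.vecTail, realVec, neg_add_eq_sub]
  rw [this, lin_apply]
  linear_combination (p.2 : ℝ) * hg.top_left_eq

theorem abs_Q_realVec_mul (hg : HasEndpoints g u w) (p : ℤ × ℤ) :
    |Q g (realVec p)| * |w - u| = |lin w p| * |lin u p| := by
  rw [Q_eq_Lplus_mul_Lminus, hg.Lplus_realVec, hg.Lminus_realVec, ← abs_mul, ← abs_mul, ← abs_neg]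
  congr 1
  linear_combination lin w p * lin u p * hg.bottom_mul_sub_eq_one

end HasEndpoints

theorem IsHReduced.exists_hasEndpoints {g : SL(2, ℝ)} (hg : IsHReduced g) {w : ℝ}
    (hw : bdryAct g OnePoint.infty = (w : OnePoint ℝ)) :
    ∃ u, HasEndpoints g u w ∧ IsReduced u w := by
  obtain ⟨u, w', hu, hw', hred⟩ := hg
  obtain rfl : w' = w := OnePoint.coe_injective (hw'.symm.trans hw)
  exact ⟨u, ⟨hu, hw⟩, hred⟩

/-- The one of `p` and `-p` at which `L_g^-` is positive, if either; convergents are only determined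
up to sign, solutions have positive `L_g^-`. -/
def orient (g : SL(2, ℝ)) (p : ℤ × ℤ) : ℤ × ℤ := if 0 < Lminus g (realVec p) then p else -p

theorem orient_eq_or_eq_neg (g : SL(2, ℝ)) (p : ℤ × ℤ) : orient g p = p ∨ orient g p = -p :=
  ite_eq_or_eq _ _ _

theorem orient_mem_primitivePairs_iff {g : SL(2, ℝ)} {p : ℤ × ℤ} :
    orient g p ∈ primitivePairs ↔ p ∈ primitivePairs := by
  rcases orient_eq_or_eq_neg g p with h | h <;> rw [h]
  exact neg_mem_primitivePairs_iff

theorem abs_lin_orient (g : SL(2, ℝ)) (ξ : ℝ) (p : ℤ × ℤ) : |lin ξ (orient g p)| = |lin ξ p| := by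
  rcases orient_eq_or_eq_neg g p with h | h <;> rw [h]
  rw [map_neg, abs_neg]

theorem euclNorm_orient (g : SL(2, ℝ)) (p : ℤ × ℤ) : euclNorm (orient g p) = euclNorm p := by
  rcases orient_eq_or_eq_neg g p with h | h <;> rw [h]
  exact euclNorm_neg p

theorem Lminus_realVec_neg (g : SL(2, ℝ)) (p : ℤ × ℤ) :
    Lminus g (realVec (-p)) = -Lminus g (realVec p) := by
  have : realVec (-p) = -realVec p := by simp [realVec]
  rw [Lminus, this, Matrix.mulVec_neg, Pi.neg_apply, ← Lminus]

theorem Lminus_realVec_orient (g : SL(2, ℝ)) (p : ℤ × ℤ) :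
    Lminus g (realVec (orient g p)) = |Lminus g (realVec p)| := by
  unfold orient
  split_ifs with h
  · rw [abs_of_pos h]
  · rw [Lminus_realVec_neg, abs_of_nonpos (not_lt.mp h)]

theorem eq_orient_of_Lminus_pos {g : SL(2, ℝ)} {p q : ℤ × ℤ} (h : p = q ∨ p = -q)
    (hp : 0 < Lminus g (realVec p)) : p = orient g q := by
  rcases h with rfl | rfl
  · exact (if_pos hp).symm
  · rw [Lminus_realVec_neg, neg_pos] at hp
    exact (if_neg hp.not_gt).symm

/-! ### Counting solutions -/

section Counting

variable {g : SL(2, ℝ)} {u w δ κ : ℝ}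

theorem abs_Q_orient_convergent_mul (hg : HasEndpoints g u w)
    (h : IsReducedExpansion (digit w) u w) (n : ℕ) :
    |Q g (realVec (orient g (convergent (digit w) (n + 1))))| *
      |orbit (digit w) w n - orbit (digit w) u n| = 1 := by
  have hwu : |w - u| ≠ 0 := abs_ne_zero.mpr (sub_ne_zero.mpr hg.ne.symm)
  rw [← mul_left_inj' hwu, mul_right_comm, hg.abs_Q_realVec_mul, abs_lin_orient, abs_lin_orient,
    h.abs_lin_mul_abs_lin_convergent_mul, one_mul]

theorem orient_convergent_mem_solutions_iff (hg : HasEndpoints g u w)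
    (h : IsReducedExpansion (digit w) u w) (hδ : 0 < δ) {ρ : ℝ} {n : ℕ} :
    orient g (convergent (digit w) (n + 1)) ∈ solutions g δ κ ρ ↔
      2 / δ ^ 2 < |orbit (digit w) w n - orbit (digit w) u n| ∧
      κ < |g.val 1 1| * |lin u (convergent (digit w) (n + 1))| ∧
      euclNorm (convergent (digit w) (n + 1)) ≤ ρ := by
  have hpos : 0 < |orbit (digit w) w n - orbit (digit w) u n| := by
    linarith [(h n).two_sub_lam_lt_abs_sub, lam_mem_Ioo.2]
  have hQ := eq_one_div_of_mul_eq_one_left (abs_Q_orient_convergent_mul hg h n)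
  have hsmall : 1 / |orbit (digit w) w n - orbit (digit w) u n| < 1 / 2 * δ ^ 2 ↔
      2 / δ ^ 2 < |orbit (digit w) w n - orbit (digit w) u n| := by
    rw [one_div_lt hpos (by positivity), one_div_mul_eq_div, one_div_div]
  rw [solutions, Set.mem_ofPred_eq, orient_mem_primitivePairs_iff, hQ, hsmall,
    Lminus_realVec_orient, hg.Lminus_realVec, abs_mul, euclNorm_orient]
  simp only [convergent_succ_mem_primitivePairs, one_div_pos.mpr hpos, true_and]

theorem injective_orient_convergent (h : IsReducedExpansion (digit w) u w) :
    Function.Injective fun n => orient g (convergent (digit w) (n + 1)) := fun i j hij => by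
  have := congrArg (fun p => |lin u p|) hij
  simp only [abs_lin_orient] at this
  exact h.strictMono_abs_lin_left_convergent.injective this

theorem exists_euclNorm_convergent_le (huw : u ≠ w) (h : IsReducedExpansion (digit w) u w) :
    ∃ C > 0, ∀ m n, m ≤ n →
      euclNorm (convergent (digit w) (m + 1)) ≤ C * Real.exp (alpha w n + c₀ * n) := by
  obtain ⟨C, hC, hnorm⟩ := exists_euclNorm_le_mul_abs_lin huw
  refine ⟨C * 2, by positivity, fun m n hmn => (hnorm _).trans ?_⟩
  rw [mul_assoc]
  refine mul_le_mul_of_nonneg_left ?_ hC.le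
  linarith [h.one_le_abs_lin_left_convergent m, h.abs_lin_right_convergent_le_one m,
    h.abs_lin_left_convergent_le_exp hmn]

theorem exists_forall_lt_mul_abs_lin_left_convergent (h : IsReducedExpansion (digit w) u w) {d : ℝ}
    (hd : 0 < d) (κ : ℝ) :
    ∃ J, ∀ n, J ≤ n → κ < d * |lin u (convergent (digit w) (n + 1))| := by
  obtain ⟨J, hJ⟩ := pow_unbounded_of_one_lt (κ / d) (by norm_num : (1 : ℝ) < 3 / 2)
  refine ⟨J, fun n hn => (div_lt_iff₀' hd).mp ?_⟩
  calc κ / d < (3 / 2) ^ J := hJ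
    _ ≤ (3 / 2) ^ n := pow_le_pow_right₀ (by norm_num) hn
    _ ≤ |lin u (convergent (digit w) (n + 1))| := h.pow_le_abs_lin_left_convergent n

theorem exists_eCount_le_ncard_solutions (hg : HasEndpoints g u w)
    (h : IsReducedExpansion (digit w) u w) (hδ : 0 < δ) (κ : ℝ) :
    ∃ (θ : ℝ) (ν : ℕ), ∀ (n : ℕ) (ρ : ℝ), 0 < ρ → alpha w n + c₀ * n + θ ≤ Real.log ρ →
      eCount w δ n ≤ (solutions g δ κ ρ).ncard + ν := by
  obtain ⟨C, hC, hnorm⟩ := exists_euclNorm_convergent_le hg.ne h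
  obtain ⟨J, hJ⟩ := exists_forall_lt_mul_abs_lin_left_convergent h
    (abs_pos.mpr hg.bottom_right_ne_zero) κ
  refine ⟨Real.log C, J, fun n ρ hρ hle => ?_⟩
  have hCρ : C * Real.exp (alpha w n + c₀ * n) ≤ ρ := by
    rwa [Real.le_log_iff_exp_le hρ, Real.exp_add, Real.exp_log hC, mul_comm] at hle
  set S := {j ∈ Finset.range n | 2 / δ ^ 2 + 1 / 2 + lam < absDigit w j} with hS
  have hmaps : ∀ j ∈ (↑(S \ Finset.range J) : Set ℕ),
      orient g (convergent (digit w) (j + 1)) ∈ solutions g δ κ ρ := fun j hj => by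
    simp only [hS, Finset.mem_coe, Finset.mem_sdiff, Finset.mem_filter, Finset.mem_range,
      not_lt] at hj
    obtain ⟨⟨hjn, hdigit⟩, hJj⟩ := hj
    refine (orient_convergent_mem_solutions_iff hg h hδ).mpr
      ⟨?_, hJ j hJj, (hnorm j n hjn.le).trans hCρ⟩
    rw [absDigit] at hdigit
    linarith [(h.abs_orbit_sub_mem_Icc j).1]
  calc S.card ≤ (S \ Finset.range J).card + J := by
        simpa using Finset.card_le_card_sdiff_add_card (s := S) (t := Finset.range J)
    _ ≤ (solutions g δ κ ρ).ncard + J := by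
        rw [← Set.ncard_coe_finset (S \ _)]
        exact Nat.add_le_add_right (Set.ncard_le_ncard_of_injOn _ hmaps
          (injective_orient_convergent h).injOn (solutions_finite g δ κ ρ)) J

theorem exists_mem_solutions_of_abs_lin_left_lt_one (hg : HasEndpoints g u w) (hκ : 0 < κ) :
    ∃ R, ∀ ρ, ∀ p ∈ solutions g δ κ ρ, |lin u p| < 1 → p ∈ solutions g δ κ R := by
  obtain ⟨C, hC, hnorm⟩ := exists_euclNorm_le_mul_abs_lin hg.ne
  refine ⟨C * (1 + 1 / 2 * δ ^ 2 * |w - u| * |g.val 1 1| / κ), ?_⟩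
  rintro ρ p ⟨hp, hQ₀, hQ, hL, -⟩ hlt
  refine ⟨hp, hQ₀, hQ, hL, (hnorm p).trans ?_⟩
  refine mul_le_mul_of_nonneg_left (add_le_add hlt.le ?_) hC.le
  rw [le_div_iff₀ hκ]
  calc |lin w p| * κ ≤ |lin w p| * (|g.val 1 1| * |lin u p|) := by
        rw [← abs_mul, ← hg.Lminus_realVec]
        exact mul_le_mul_of_nonneg_left (hL.le.trans (le_abs_self _)) (abs_nonneg _)
    _ = |Q g (realVec p)| * |w - u| * |g.val 1 1| := by
        rw [hg.abs_Q_realVec_mul]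
        ring
    _ ≤ 1 / 2 * δ ^ 2 * |w - u| * |g.val 1 1| := by gcongr

theorem exists_eq_orient_convergent (hg : HasEndpoints g u w)
    (h : IsReducedExpansion (digit w) u w) (hδ : δ ^ 2 ≤ 2 * lam) (hκ : 0 < κ) {ρ : ℝ}
    {p : ℤ × ℤ} (hp : p ∈ solutions g δ κ ρ) (h₁ : 1 ≤ |lin u p|) :
    ∃ n, p = orient g (convergent (digit w) (n + 1)) := by
  obtain ⟨hprim, -, hQ, hL, -⟩ := hp
  have hwu : 0 < |w - u| := abs_pos.mpr (sub_ne_zero.mpr hg.ne.symm)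
  obtain ⟨n, hn⟩ := h.exists_eq_convergent_or_eq_neg hprim h₁ (by
    rw [← hg.abs_Q_realVec_mul]
    exact mul_lt_mul_of_pos_right (by linarith) hwu)
  exact ⟨n, eq_orient_of_Lminus_pos hn (hκ.trans hL)⟩

theorem lt_of_euclNorm_convergent_le (h : IsReducedExpansion (digit w) u w) {m n : ℕ} {ρ : ℝ}
    (hρ : 2 * (1 + |u|) * ρ < Real.exp (alpha w n - omega w n))
    (hm : euclNorm (convergent (digit w) (m + 1)) ≤ ρ) : m < n := by
  refine h.strictMono_abs_lin_left_convergent.lt_iff_lt.mp ?_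
  have hle : |lin u (convergent (digit w) (m + 1))| ≤ (1 + |u|) * ρ :=
    (abs_lin_le_mul_euclNorm u _).trans (mul_le_mul_of_nonneg_left hm (by positivity))
  linarith [h.exp_le_two_mul_abs_lin_left_convergent n]

theorem exists_ncard_solutions_le_fCount (hg : HasEndpoints g u w)
    (h : IsReducedExpansion (digit w) u w) (hδ₀ : 0 < δ) (hδ : δ ^ 2 ≤ 2 * lam) (hκ : 0 < κ) :
    ∃ (θ : ℝ) (ν : ℕ), ∀ (n : ℕ) (ρ : ℝ), 0 < ρ → Real.log ρ ≤ alpha w n - omega w n - θ →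
      (solutions g δ κ ρ).ncard ≤ fCount w δ n + ν := by
  obtain ⟨R, hR⟩ := exists_mem_solutions_of_abs_lin_left_lt_one (δ := δ) hg hκ
  refine ⟨Real.log (2 * (1 + |u|)) + 1, (solutions g δ κ R).ncard, fun n ρ hρ hle => ?_⟩
  have hexp : 2 * (1 + |u|) * ρ < Real.exp (alpha w n - omega w n) := by
    rw [← Real.log_lt_iff_lt_exp (by positivity), Real.log_mul (by positivity) hρ.ne']
    linarith
  set S := {j ∈ Finset.range n | 2 / δ ^ 2 - 3 / 2 + lam < absDigit w j} with hS
  have hsub : solutions g δ κ ρ ⊆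
      (fun j => orient g (convergent (digit w) (j + 1))) '' S ∪ solutions g δ κ R := by
    intro p hp
    rcases lt_or_ge |lin u p| 1 with hlt | hge
    · exact Or.inr (hR ρ p hp hlt)
    · obtain ⟨j, rfl⟩ := exists_eq_orient_convergent hg h hδ hκ hp hge
      obtain ⟨hlarge, -, hnorm⟩ := (orient_convergent_mem_solutions_iff hg h hδ₀).mp hp
      refine Or.inl ⟨j, ?_, rfl⟩
      rw [hS, Finset.mem_coe, Finset.mem_filter, Finset.mem_range, absDigit]
      exact ⟨lt_of_euclNorm_convergent_le h hexp hnorm,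
        by linarith [(h.abs_orbit_sub_mem_Icc j).2]⟩
  calc (solutions g δ κ ρ).ncard
      ≤ ((fun j => orient g (convergent (digit w) (j + 1))) '' S ∪ solutions g δ κ R).ncard :=
        Set.ncard_le_ncard hsub ((S.finite_toSet.image _).union (solutions_finite g δ κ R))
    _ ≤ ((fun j => orient g (convergent (digit w) (j + 1))) '' S).ncard +
          (solutions g δ κ R).ncard := Set.ncard_union_le _ _
    _ ≤ S.card + (solutions g δ κ R).ncard := by
        rw [← Set.ncard_coe_finset S]
        exact Nat.add_le_add_right (Set.ncard_image_le S.finite_toSet) _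

end Counting

theorem sq_le_two_mul_lam {δ : ℝ} (hδ₀ : 0 < δ) (hδ : δ < √(2 / Real.pi)) : δ ^ 2 ≤ 2 * lam := by
  have hπ : 2 / Real.pi < 2 / 3 :=
    div_lt_div_of_pos_left two_pos three_pos Real.pi_gt_three
  linarith [(Real.lt_sqrt hδ₀.le).mp hδ, lam_mem_Ioo.1]

end HReducedForms

end

open HReducedForms in
theorem theorem4p1_general (g : SL(2, ℝ)) (hg : IsHReduced g) (w : ℝ)
    (hw : bdryAct g OnePoint.infty = (w : OnePoint ℝ)) (hirr : Irrational w)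
    (δ κ : ℝ) (hδ₀ : 0 < δ) (hδ : δ ^ 2 ≤ 2 * lam) (hκ : 0 < κ) :
    ∃ (θ : ℝ) (ν : ℕ), 0 ≤ θ ∧ ∀ (n : ℕ) (ρ : ℝ), 0 < ρ →
      (alpha w n + c₀ * n + θ ≤ Real.log ρ →
        (eCount w δ n : ℝ) - ν ≤ (solutions g δ κ ρ).ncard) ∧
      (Real.log ρ ≤ alpha w n - omega w n - θ →
        ((solutions g δ κ ρ).ncard : ℝ) ≤ fCount w δ n + ν) := by
  obtain ⟨u, hends, hred⟩ := hg.exists_hasEndpoints hw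
  have hexp := hred.isReducedExpansion_digit hirr
  obtain ⟨θ₁, ν₁, hlower⟩ := exists_eCount_le_ncard_solutions hends hexp hδ₀ κ
  obtain ⟨θ₂, ν₂, hupper⟩ := exists_ncard_solutions_le_fCount hends hexp hδ₀ hδ hκ
  refine ⟨max 0 (max θ₁ θ₂), ν₁ + ν₂, le_max_left _ _, fun n ρ hρ => ⟨fun hle => ?_, fun hle => ?_⟩⟩
  · have hθ : θ₁ ≤ max 0 (max θ₁ θ₂) := (le_max_left _ _).trans (le_max_right _ _)
    rw [sub_le_iff_le_add]
    exact_mod_cast (hlower n ρ hρ (by linarith)).trans (by lia)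
  · have hθ : θ₂ ≤ max 0 (max θ₁ θ₂) := (le_max_right _ _).trans (le_max_right _ _)
    exact_mod_cast (hupper n ρ hρ (by linarith)).trans (by lia)

theorem theorem4p1 (g : Matrix.SpecialLinearGroup (Fin 2) ℝ) (hg : HReducedForms.IsHReduced g)
    (w : ℝ) (hw : HReducedForms.bdryAct g OnePoint.infty = (w : OnePoint ℝ))
    (hirr : Irrational w)
    (δ κ : ℝ) (hδ0 : 0 < δ) (hδ : δ < √(2 / Real.pi)) (hκ : 0 < κ) :
    ∃ (θ : ℝ) (ν : ℕ), 0 ≤ θ ∧ ∀ (n : ℕ) (ρ : ℝ), 0 < ρ →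
      (HReducedForms.alpha w n + HReducedForms.c₀ * n + θ ≤ Real.log ρ →
        (HReducedForms.eCount w δ n : ℝ) - ν ≤ (HReducedForms.solutions g δ κ ρ).ncard) ∧
      (Real.log ρ ≤ HReducedForms.alpha w n - HReducedForms.omega w n - θ →
        ((HReducedForms.solutions g δ κ ρ).ncard : ℝ) ≤ HReducedForms.fCount w δ n + ν) :=
  theorem4p1_general g hg w hw hirr δ κ hδ0 (HReducedForms.sq_le_two_mul_lam hδ0 hδ) hκ
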